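/- Let $\mathbb K$ be one of $\mathbb R$, $\mathbb C$, $\mathbb H$ (quaternions), and let $\delta=1,2,4$ respectively be its real dimension. Consider $\mathbb K^m$ as a right $\mathbb K$-linear space of columns $x=(\xi_i)_{i=1}^m$, and write $\ell_{p;\mathbb K}^m$ for this space with the norm $\|x\|_p=\bigl(\sum_{i=1}^m|\xi_i|^p\bigr)^{1/p}$. For $m\ge 1$ and even $p\ge 2$, let $N_{\mathbb K}(m,p)$ be the minimal $n$ such that there exists a $\mathbb K$-linear isometric embedding $\ell_{2;\mathbb K}^m\to\ell_{p;\mathbb K}^n$. Let $m\ge 2$ and let $p\ge 4$ be an even integer. Then the numbers $N$ below exist (that is, the corresponding isometric embeddings exist for some $n$), and $$ N_{\mathbb K}(m,p)\le \begin{cases} N_{\mathbb R}\left(\delta,\tfrac p2-1\right)\left(\tfrac p2+1\right)N_{\mathbb R}\left(\delta(m-1),p\right), & p\equiv 2 \pmod 4,\\[4pt] N_{\mathbb R}\left(\delta,\tfrac p2\right)\left(\tfrac p2\,N_{\mathbb R}\left(\delta(m-1),p\right)+1\right), & p\equiv 0 \pmod 4. \end{cases} $$ -/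

import Mathlib

open scoped Quaternion

/-- The right `F`-linear space `F^n` of columns with the norm `(∑ |ξ_i|^q)^(1/q)`,
for a positive integer `q`. -/
abbrev EllSpace (F : Type) (n q : ℕ) : Type :=
  PiLp (q : ENNReal) (fun _ : Fin n => F)

/-- There is a (right `F`-linear) isometric embedding of `F^m` with the Euclidean norm into `F^n`
with the `p`-norm. Right scalar multiplication is the action of the opposite ring. -/
def HasIsometricEmbedding (F : Type) [NormedRing F] (m p n : ℕ) : Prop :=
  ∃ f : EllSpace F m 2 →ₗ[Fᵐᵒᵖ] EllSpace F n p, ∀ y : EllSpace F m 2, ‖f y‖ = ‖y‖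

/-- The three classical fields: real numbers, complex numbers, quaternions. -/
inductive ClassicalField : Type
  | real
  | complex
  | quaternion

namespace ClassicalField

/-- The real dimension `δ` of a classical field. -/
def realDim : ClassicalField → ℕ
  | real => 1
  | complex => 2
  | quaternion => 4

/-- The set of all `n` such that a `K`-linear isometric embedding of the `m`-dimensional
Euclidean space over `K` into the `n`-dimensional `ℓ_p` space over `K` exists. -/
def embeddingDims (K : ClassicalField) (m p : ℕ) : Set ℕ :=
  match K with
  | real => {n | HasIsometricEmbedding ℝ m p n}
  | complex => {n | HasIsometricEmbedding ℂ m p n}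
  | quaternion => {n | HasIsometricEmbedding ℍ[ℝ] m p n}

/-- `N_K(m, p)`: the minimal `n` such that an isometric embedding as above exists. (It is
meaningful when `embeddingDims K m p` is non-empty.) -/
noncomputable def minDim (K : ClassicalField) (m p : ℕ) : ℕ :=
  sInf (K.embeddingDims m p)

end ClassicalField

/-! Put `P = p / 2`, let `d`, `D` be the real dimensions of `F` and `F ^ (m - 1)`, and split a
column as `(ξ, y)`. An embedding is a positive combination of powers `|·| ^ (2 * P)` of linear forms
equal to a multiple of `(‖ξ‖² + ‖y‖²) ^ P`. The forms used are `θ_i ξ ± √t_k ⟨ω_j, y⟩`, where `θ` is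
a design on the unit sphere of `F`, `ω` one on the real unit sphere of `F ^ (m - 1)`, and `⟨ω, y⟩ =
∑ ω_l y_l`.

The sign kills odd powers of the cross term, so `θ` need only have degree `2⌊P/2⌋`, which explains
the small first factor of the bound (`IsDesign.sum_norm_mul_add_pow`). Averaging over `ω` turns
`|⟨ω, y⟩| ^ (2n)` into a multiple of `‖y‖ ^ (2n)` (`IsDesign.sum_norm_sum_mul_pow`). What remains is
a form in `‖ξ‖²` and `‖y‖²` whose coefficients differ from the binomial ones by the factors `1 /
((D/2)_n (d/2)_{P-n})`.

The nodes `t_k` repair this: their weighted `n`-th moments must be `(D/2)_n (d/2)_{P-n}` for `n ≤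
P`. These are moments of a positive measure on the half-line, so Gauss quadrature with `(P+1)/2`
nodes works for odd `P`, and Gauss–Radau with `P/2` nodes and the node `0` for even `P`
(`exists_quadrature_odd`, `exists_quadrature_even`). At `t = 0` the forms depend on `ξ` alone, which
gives the `+ 1` of the second bound.

Designs come from optimal real embeddings by repeated use of the Laplacian
(`IsCubature.exists_isDesign`). Real embeddings exist by the same construction over `ℝ`, adding one
coordinate at a time. -/

/-! ### Pochhammer identities and moments of the sphere -/

open Finset in
/-- A form of the Chu–Vandermonde identity. -/
theorem sum_antidiagonal_choose_mul_descPochhammer_mul_ascPochhammer (n : ℕ) (a M : ℝ) :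
    ∑ ij ∈ antidiagonal n, (n.choose ij.1 : ℝ) *
      ((descPochhammer ℝ ij.1).eval M * (ascPochhammer ℝ ij.2).eval (a + ij.1)) =
      (ascPochhammer ℝ n).eval (a + M) := by
  induction n generalizing a M with
  | zero => simp
  | succ n ih =>
    rw [sum_antidiagonal_choose_succ_mul
      (fun i j => (descPochhammer ℝ i).eval M * (ascPochhammer ℝ j).eval (a + i))]
    have h1 : ∑ ij ∈ antidiagonal n, (n.choose ij.1 : ℝ) *
        ((descPochhammer ℝ ij.1).eval M * (ascPochhammer ℝ (ij.2 + 1)).eval (a + ij.1)) =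
        (a + n) * (ascPochhammer ℝ n).eval (a + M) := by
      rw [← ih, mul_sum]
      refine sum_congr rfl fun ij hij => ?_
      rw [HasAntidiagonal.mem_antidiagonal] at hij
      rw [ascPochhammer_succ_eval, ← hij]
      push_cast
      ring
    have h2 : ∑ ij ∈ antidiagonal n, (n.choose ij.2 : ℝ) *
        ((descPochhammer ℝ (ij.1 + 1)).eval M * (ascPochhammer ℝ ij.2).eval (a + (ij.1 + 1 : ℕ))) =
        M * (ascPochhammer ℝ n).eval (a + M) := by
      have h := ih (a + 1) (M - 1)
      rw [show a + 1 + (M - 1) = a + M by ring] at h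
      rw [← h, mul_sum]
      refine sum_congr rfl fun ij hij => ?_
      rw [HasAntidiagonal.mem_antidiagonal] at hij
      rw [descPochhammer_succ_left, Nat.choose_symm_of_eq_add hij.symm]
      simp only [Polynomial.eval_mul, Polynomial.eval_X, Polynomial.eval_comp,
        Polynomial.eval_sub, Polynomial.eval_one]
      rw [show a + ((ij.1 + 1 : ℕ) : ℝ) = a + 1 + ij.1 by push_cast; ring]
      ring
    rw [h1, h2, ascPochhammer_succ_eval]
    ring

/-- The mean of `⟪θ, x⟫ ^ (2 * j)` over the unit sphere of a `d`-dimensional Euclidean space,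
for a unit vector `x`. -/
noncomputable def sphereMoment (d j : ℕ) : ℝ :=
  ∏ i ∈ Finset.range j, (2 * i + 1 : ℝ) / (d + 2 * i)

theorem sphereMoment_zero (d : ℕ) : sphereMoment d 0 = 1 := by simp [sphereMoment]

theorem sphereMoment_succ (d j : ℕ) :
    sphereMoment d (j + 1) = sphereMoment d j * ((2 * j + 1) / (d + 2 * j)) :=
  Finset.prod_range_succ _ _

theorem sphereMoment_pos {d : ℕ} (hd : 0 < d) (j : ℕ) : 0 < sphereMoment d j := by
  have : (0 : ℝ) < d := by exact_mod_cast hd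
  exact Finset.prod_pos fun i _ => by positivity

theorem ascPochhammer_half_pos {d : ℕ} (hd : 0 < d) (n : ℕ) :
    0 < (ascPochhammer ℝ n).eval (d / 2 : ℝ) :=
  ascPochhammer_pos n _ (by positivity)

theorem four_pow_mul_sphereMoment {d : ℕ} (hd : 0 < d) (j : ℕ) :
    4 ^ j * sphereMoment d j * (j.factorial * (ascPochhammer ℝ j).eval (d / 2 : ℝ)) =
      (2 * j).factorial := by
  have hd' : (0 : ℝ) < d := by exact_mod_cast hd
  induction j with
  | zero => simp [sphereMoment]
  | succ j ih =>
    rw [sphereMoment_succ, ascPochhammer_succ_eval, Nat.factorial_succ,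
      show 2 * (j + 1) = 2 * j + 1 + 1 by ring, Nat.factorial_succ (2 * j + 1),
      Nat.factorial_succ (2 * j)]
    push_cast
    rw [← ih]
    have : (d + 2 * j : ℝ) ≠ 0 := by positivity
    field_simp
    ring

/-- This ratio is the factor produced by averaging over the sphere of `F ^ m` instead of that of
`F`; it replaces `(d/2)_n` by `(D/2)_n` in the denominators. -/
theorem sphereMoment_div {d D : ℕ} (hd : 0 < d) (hD : 0 < D) (n : ℕ) :
    sphereMoment D n / sphereMoment d n =
      (ascPochhammer ℝ n).eval (d / 2 : ℝ) / (ascPochhammer ℝ n).eval (D / 2 : ℝ) := by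
  have h1 := four_pow_mul_sphereMoment hd n
  have h2 := four_pow_mul_sphereMoment hD n
  rw [← h1] at h2
  rw [div_eq_div_iff (sphereMoment_pos hd n).ne' (ascPochhammer_half_pos hD n).ne']
  have h : (4 ^ n * n.factorial : ℝ) ≠ 0 := by positivity
  apply mul_left_cancel₀ h
  linear_combination h2

theorem ascPochhammer_eval_add (a : ℝ) (n k : ℕ) :
    (ascPochhammer ℝ (n + k)).eval a =
      (ascPochhammer ℝ n).eval a * (ascPochhammer ℝ k).eval (a + n) := by
  rw [← ascPochhammer_mul]
  simp [Polynomial.eval_comp]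

-- By Chu–Vandermonde, `(a)_{n+M} / (a)_M = (a + M)_n` expands in falling factorials of `M`, and `(a
-- + k)_{n-k} / (a)_n = 1 / (a)_k`. The terms with `k > M` vanish.
open Finset in
theorem choose_mul_ascPochhammer_div {a : ℝ} (ha : 0 < a) (n M : ℕ) :
    ((n + M).choose n : ℝ) * ((ascPochhammer ℝ (n + M)).eval a /
      ((ascPochhammer ℝ n).eval a * (ascPochhammer ℝ M).eval a)) =
    ∑ k ∈ range (min n M + 1), ((n + M).factorial : ℝ) /
      ((n - k).factorial * (M - k).factorial * (k.factorial * (ascPochhammer ℝ k).eval a)) := by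
  have hp : ∀ k, (ascPochhammer ℝ k).eval a ≠ 0 := fun k => (ascPochhammer_pos k a ha).ne'
  have h := sum_antidiagonal_choose_mul_descPochhammer_mul_ascPochhammer n a M
  rw [Nat.sum_antidiagonal_eq_sum_range_succ_mk] at h
  have hsub : range (min n M + 1) ⊆ range (n + 1) := by
    intro k; simp only [mem_range]; omega
  rw [← sum_subset hsub] at h
  · have h2 : (ascPochhammer ℝ (n + M)).eval a /
        ((ascPochhammer ℝ n).eval a * (ascPochhammer ℝ M).eval a) =
        (ascPochhammer ℝ n).eval (a + M) / (ascPochhammer ℝ n).eval a := by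
      rw [add_comm n M, ascPochhammer_eval_add, mul_comm, mul_div_mul_right _ _ (hp M)]
    rw [h2, ← h, sum_div, mul_sum]
    refine sum_congr rfl fun k hk => ?_
    simp only [mem_range] at hk
    obtain ⟨r, rfl⟩ := Nat.exists_eq_add_of_le (show k ≤ n by omega)
    obtain ⟨s, rfl⟩ := Nat.exists_eq_add_of_le (show k ≤ M by omega)
    rw [descPochhammer_eval_eq_descFactorial, ascPochhammer_eval_add,
      ← Nat.add_choose_mul_factorial_mul_factorial (k + r) (k + s)]
    simp only [Nat.add_sub_cancel_left]
    have h3 := Nat.factorial_mul_descFactorial (show k ≤ k + s by omega)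
    have h4 := Nat.add_choose_mul_factorial_mul_factorial k r
    rw [Nat.add_sub_cancel_left] at h3
    rw [← h3, ← h4]
    have h5 := hp k
    have h6 := (ascPochhammer_pos r (a + k) (by positivity)).ne'
    rw [Nat.choose_symm_add (a := k) (b := r), Nat.choose_symm_add (a := k + r) (b := k + s)]
    push_cast
    field_simp
  · intro k hk hk'
    simp only [mem_range] at hk hk'
    rw [descPochhammer_eval_eq_descFactorial, Nat.descFactorial_eq_zero_iff_lt.2 (by omega)]
    simp

open Finset in
/-- The average of `‖x + θ‖ ^ (2 * P)` over a sphere: here `B = ‖x‖ ^ 2` and `Z = ‖θ‖ ^ 2`. -/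
theorem sum_choose_mul_sphereMoment {d : ℕ} (hd : 0 < d) (P : ℕ) (B Z : ℝ) :
    ∑ k ∈ range (P / 2 + 1), (P.choose (2 * k) : ℝ) * (4 ^ k * sphereMoment d k) *
      ((B * Z) ^ k * (B + Z) ^ (P - 2 * k)) =
    ∑ n ∈ range (P + 1), (P.choose n : ℝ) * ((ascPochhammer ℝ P).eval (d / 2 : ℝ) /
      ((ascPochhammer ℝ n).eval (d / 2 : ℝ) * (ascPochhammer ℝ (P - n)).eval (d / 2 : ℝ))) *
      (Z ^ n * B ^ (P - n)) := by
  have hd' : (0 : ℝ) < d / 2 := by positivity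
  have hp : ∀ k, (ascPochhammer ℝ k).eval (d / 2 : ℝ) ≠ 0 :=
    fun k => (ascPochhammer_pos k _ hd').ne'
  have hr : ∀ n ∈ range (P + 1), (P.choose n : ℝ) * ((ascPochhammer ℝ P).eval (d / 2 : ℝ) /
      ((ascPochhammer ℝ n).eval (d / 2 : ℝ) * (ascPochhammer ℝ (P - n)).eval (d / 2 : ℝ))) *
      (Z ^ n * B ^ (P - n)) = ∑ k ∈ range (min n (P - n) + 1), (P.factorial : ℝ) /
      ((n - k).factorial * (P - n - k).factorial *
        (k.factorial * (ascPochhammer ℝ k).eval (d / 2 : ℝ))) * (Z ^ n * B ^ (P - n)) := by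
    intro n hn
    obtain ⟨M, rfl⟩ := Nat.exists_eq_add_of_le (Nat.lt_succ_iff.1 (mem_range.1 hn))
    rw [Nat.add_sub_cancel_left, choose_mul_ascPochhammer_div hd' n M, sum_mul]
  have hl : ∀ k ∈ range (P / 2 + 1), (P.choose (2 * k) : ℝ) * (4 ^ k * sphereMoment d k) *
      ((B * Z) ^ k * (B + Z) ^ (P - 2 * k)) = ∑ l ∈ range (P - 2 * k + 1), (P.factorial : ℝ) /
      (l.factorial * (P - 2 * k - l).factorial *
        (k.factorial * (ascPochhammer ℝ k).eval (d / 2 : ℝ))) *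
        (Z ^ (k + l) * B ^ (P - (k + l))) := by
    intro k hk
    rw [add_comm B Z, add_pow, mul_sum, mul_sum]
    refine sum_congr rfl fun l hl => ?_
    obtain ⟨M, rfl⟩ := Nat.exists_eq_add_of_le (show 2 * k ≤ P by rw [mem_range] at hk; omega)
    rw [Nat.add_sub_cancel_left] at hl ⊢
    obtain ⟨N, rfl⟩ := Nat.exists_eq_add_of_le (Nat.lt_succ_iff.1 (mem_range.1 hl))
    rw [Nat.add_sub_cancel_left, show 2 * k + (l + N) - (k + l) = k + N by omega,
      ← Nat.add_choose_mul_factorial_mul_factorial (2 * k) (l + N),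
      ← Nat.add_choose_mul_factorial_mul_factorial l N]
    rw [Nat.choose_symm_add (a := l) (b := N), Nat.choose_symm_add (a := 2 * k) (b := l + N)]
    push_cast
    rw [← four_pow_mul_sphereMoment hd k]
    have := hp k
    field_simp
    ring
  rw [sum_congr rfl hr, sum_congr rfl hl, sum_sigma', sum_sigma']
  -- Here `k` counts factors `B * Z` and `l` the factors `Z` taken from `(B + Z) ^ (P - 2 * k)`, so
  -- the total power of `Z` is `n = k + l`.
  refine sum_bij' (fun x _ => ⟨x.1 + x.2, x.1⟩) (fun x _ => ⟨x.2, x.1 - x.2⟩) ?_ ?_ ?_ ?_ ?_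
  · rintro ⟨k, l⟩ h
    simp only [mem_sigma, mem_range] at h ⊢
    omega
  · rintro ⟨k, l⟩ h
    simp only [mem_sigma, mem_range] at h ⊢
    omega
  · rintro ⟨k, l⟩ h
    simp
  · rintro ⟨k, l⟩ h
    simp only [mem_sigma, mem_range] at h ⊢
    simp only [Sigma.mk.injEq, heq_eq_eq, and_true]
    omega
  · rintro ⟨k, l⟩ h
    simp only [mem_sigma, mem_range] at h ⊢
    rw [Nat.add_sub_cancel_left, show P - (k + l) - k = P - 2 * k - l by omega]

/-! ### Beta integrals and positivity of the radial moments -/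

open MeasureTheory Set in
theorem integral_Ioo_rpow_mul_one_sub_rpow {a b : ℝ} (ha : 0 < a) (hb : 0 < b) :
    IntegrableOn (fun x : ℝ => x ^ (a - 1) * (1 - x) ^ (b - 1)) (Ioo 0 1) ∧
    ∫ x in Ioo (0 : ℝ) 1, x ^ (a - 1) * (1 - x) ^ (b - 1) =
      Real.Gamma a * Real.Gamma b / Real.Gamma (a + b) := by
  have h : ∫ x in Ioo (0 : ℝ) 1, x ^ (a - 1) * (1 - x) ^ (b - 1) =
      Real.Gamma a * Real.Gamma b / Real.Gamma (a + b) := by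
    change _ = ProbabilityTheory.beta a b
    rw [← Complex.ofReal_inj, ProbabilityTheory.beta, Complex.ofReal_div, Complex.ofReal_mul,
      ← Complex.Gamma_ofReal, ← Complex.Gamma_ofReal, ← Complex.Gamma_ofReal, Complex.ofReal_add,
      ← Complex.betaIntegral_eq_Gamma_mul_div _ _ (by simpa) (by simpa), Complex.betaIntegral,
      intervalIntegral.integral_of_le zero_le_one, ← integral_Ioc_eq_integral_Ioo,
      ← integral_complex_ofReal]
    refine setIntegral_congr_fun measurableSet_Ioc fun x hx => ?_
    rw [Complex.ofReal_mul, Complex.ofReal_cpow hx.1.le, Complex.ofReal_cpow (by linarith [hx.2])]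
    push_cast
    rfl
  refine ⟨?_, h⟩
  -- Integrability is read off from the value: a non-integrable function has integral `0` by
  -- convention, whereas the Beta function is positive.
  by_contra h'
  rw [integral_undef h'] at h
  exact (ProbabilityTheory.beta_pos ha hb).ne h

theorem Gamma_add_natCast {a : ℝ} (ha : 0 < a) (n : ℕ) :
    Real.Gamma (a + n) = Real.Gamma a * (ascPochhammer ℝ n).eval a := by
  induction n with
  | zero => simp
  | succ n ih =>
    rw [ascPochhammer_succ_eval, ← mul_assoc, ← ih, mul_comm, Nat.cast_succ, ← add_assoc,
      Real.Gamma_add_one (by positivity)]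

open MeasureTheory Set Polynomial in
/-- The sequence `(a)_n (b)_{P-n}` is, up to a factor, the moment sequence of a measure on the
positive half-line; hence nonzero nonnegative polynomials have positive integrals. -/
theorem sum_coeff_mul_ascPochhammer_pos {a b : ℝ} (ha : 0 < a) (hb : 0 < b) {P : ℕ} {f : ℝ[X]}
    (hf : f ≠ 0) (hdeg : f.natDegree ≤ P) (hpos : ∀ t : ℝ, 0 < t → 0 ≤ f.eval t) :
    0 < ∑ n ∈ Finset.range (P + 1), f.coeff n *
      ((ascPochhammer ℝ n).eval a * (ascPochhammer ℝ (P - n)).eval b) := by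
  set F : ℝ → ℝ := fun t => ∑ n ∈ Finset.range (P + 1),
    f.coeff n * (t ^ (a + n - 1) * (1 - t) ^ (b + (P - n : ℕ) - 1)) with hF
  have hterm : ∀ n ∈ Finset.range (P + 1), ∫ t in Ioo (0 : ℝ) 1,
      f.coeff n * (t ^ (a + n - 1) * (1 - t) ^ (b + (P - n : ℕ) - 1)) =
      f.coeff n * ((ascPochhammer ℝ n).eval a * (ascPochhammer ℝ (P - n)).eval b) *
        (Real.Gamma a * Real.Gamma b / Real.Gamma (a + b + P)) := by
    intro n hn
    rw [integral_const_mul, (integral_Ioo_rpow_mul_one_sub_rpow (by positivity)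
      (by positivity)).2, Gamma_add_natCast ha, Gamma_add_natCast hb,
      show a + n + (b + (P - n : ℕ)) = a + b + P by
        rw [Nat.cast_sub (Nat.lt_succ_iff.1 (Finset.mem_range.1 hn))]; ring]
    ring
  have hint : ∀ n ∈ Finset.range (P + 1), IntegrableOn
      (fun t : ℝ => f.coeff n * (t ^ (a + n - 1) * (1 - t) ^ (b + (P - n : ℕ) - 1)))
      (Ioo 0 1) := fun n _ =>
    ((integral_Ioo_rpow_mul_one_sub_rpow (by positivity) (by positivity)).1).const_mul _
  have hFint : ∫ t in Ioo (0 : ℝ) 1, F t =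
      (∑ n ∈ Finset.range (P + 1), f.coeff n *
        ((ascPochhammer ℝ n).eval a * (ascPochhammer ℝ (P - n)).eval b)) *
        (Real.Gamma a * Real.Gamma b / Real.Gamma (a + b + P)) := by
    rw [integral_finsetSum _ hint, Finset.sum_congr rfl hterm, Finset.sum_mul]
  have hG : 0 < Real.Gamma a * Real.Gamma b / Real.Gamma (a + b + P) := by
    have := Real.Gamma_pos_of_pos ha
    have := Real.Gamma_pos_of_pos hb
    have := Real.Gamma_pos_of_pos (show 0 < a + b + P by positivity)
    positivity
  -- The map `t ↦ t / (1 - t)` carries `(0, 1)` to the positive half-line, so the sign of `F` is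
  -- that of `f` there.
  have hFeq : ∀ t ∈ Ioo (0 : ℝ) 1,
      F t = f.eval (t / (1 - t)) * ((1 - t) ^ P * (t ^ (a - 1) * (1 - t) ^ (b - 1))) := by
    rintro t ⟨h0, h1⟩
    have h1' : 0 < 1 - t := by linarith
    rw [hF, eval_eq_sum_range' (Nat.lt_succ_of_le hdeg), Finset.sum_mul]
    refine Finset.sum_congr rfl fun n hn => ?_
    have e1 : t ^ (a + n - 1) = t ^ (a - 1) * t ^ n := by
      rw [← Real.rpow_natCast, ← Real.rpow_add h0]; congr 1; ring
    have e2 : (1 - t) ^ (b + (P - n : ℕ) - 1) = (1 - t) ^ (b - 1) * (1 - t) ^ (P - n) := by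
      rw [← Real.rpow_natCast, ← Real.rpow_add h1']; congr 1; ring
    have e3 : (1 - t) ^ P = (1 - t) ^ (P - n) * (1 - t) ^ n := by
      rw [← pow_add]; congr 1; have := Finset.mem_range.1 hn; omega
    rw [e1, e2, e3, div_pow]
    field_simp
  have hnonneg : 0 ≤ᵐ[volume.restrict (Ioo (0 : ℝ) 1)] F := by
    rw [Filter.EventuallyLE, ae_restrict_iff' measurableSet_Ioo]
    refine Filter.Eventually.of_forall fun t ht => ?_
    rw [hFeq t ht]
    have h0 := ht.1
    have h1' : 0 < 1 - t := by linarith [ht.2]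
    have := hpos (t / (1 - t)) (by positivity)
    simp only [Pi.zero_apply]
    positivity
  have hFi : IntegrableOn F (Ioo 0 1) := integrable_finsetSum _ hint
  have h0 : 0 ≤ ∫ t in Ioo (0 : ℝ) 1, F t := integral_nonneg_of_ae hnonneg
  have h1 : ∫ t in Ioo (0 : ℝ) 1, F t ≠ 0 := by
    intro h
    rw [integral_eq_zero_iff_of_nonneg_ae hnonneg hFi, Filter.EventuallyEq,
      ae_restrict_iff' measurableSet_Ioo] at h
    -- Inside `(0, 1)` the zeros of `F` are images of roots of `f` under the inverse map `s ↦ s / (1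
    -- + s)`, hence finitely many.
    have hfin : ((fun s : ℝ => s / (1 + s)) '' (f.rootSet ℝ)).Finite :=
      (f.rootSet_finite ℝ).image _
    have hae : ∀ᵐ t : ℝ, t ∉ (fun s : ℝ => s / (1 + s)) '' (f.rootSet ℝ) :=
      hfin.measure_zero volume |> measure_eq_zero_iff_ae_notMem.1
    have : ∀ᵐ t : ℝ, t ∉ Ioo (0 : ℝ) 1 := by
      filter_upwards [h, hae] with t ht ht' hmem
      apply ht'
      have h1' : 0 < 1 - t := by linarith [hmem.2]
      have h0' := hmem.1
      refine ⟨t / (1 - t), ?_, ?_⟩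
      · rw [mem_rootSet]
        refine ⟨hf, ?_⟩
        have := ht hmem
        rw [hFeq t hmem, Pi.zero_apply, mul_eq_zero] at this
        rcases this with h | h
        · simpa using h
        · exact absurd h (by positivity)
      · field_simp
        ring
    rw [← measure_eq_zero_iff_ae_notMem] at this
    simp at this
  have h2 := lt_of_le_of_ne h0 h1.symm
  rw [hFint] at h2
  exact pos_of_mul_pos_left h2 hG.le

/-! ### Gauss and Gauss–Radau quadrature -/

open Polynomial in
/-- Gauss quadrature, through the spectral theorem for the compression of the multiplication
by `X` to the polynomials of degree less than `N`. -/
theorem exists_gauss_quadrature {N : ℕ} (hN : 0 < N) (L : ℝ[X] →ₗ[ℝ] ℝ)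
    (h0 : ∀ g : ℝ[X], g ≠ 0 → g.degree < N → 0 < L (g * g))
    (h1 : ∀ g : ℝ[X], g ≠ 0 → g.degree < N → 0 < L (X * (g * g))) :
    ∃ t w : Fin N → ℝ, (∀ i, 0 < t i) ∧ (∀ i, 0 ≤ w i) ∧
      ∀ k < 2 * N, L (X ^ k) = ∑ i, w i * t i ^ k := by
  let c : InnerProductSpace.Core ℝ (degreeLT ℝ N) :=
    { inner := fun f g => L (f.1 * g.1)
      conj_inner_symm := fun f g => by simp [mul_comm]
      re_inner_nonneg := fun f => by
        by_cases hf : f.1 = 0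
        · simp [hf]
        · exact (h0 _ hf (mem_degreeLT.1 f.2)).le
      add_left := fun f g h => by simp [add_mul]
      smul_left := fun f g r => by simp
      definite := fun f hf => by
        by_contra hne
        exact (h0 f.1 (fun h => hne (Subtype.ext h)) (mem_degreeLT.1 f.2)).ne' hf }
  let _ : NormedAddCommGroup (degreeLT ℝ N) := c.toNormedAddCommGroup
  let _ : InnerProductSpace ℝ (degreeLT ℝ N) := InnerProductSpace.ofCore c.toCore
  have hinner : ∀ f g : degreeLT ℝ N, inner ℝ f g = L (f.1 * g.1) := fun _ _ => rfl
  have : FiniteDimensional ℝ (degreeLT ℝ N) :=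
    (degreeLTEquiv ℝ N).symm.finiteDimensional
  have hrank : Module.finrank ℝ (degreeLT ℝ N) = N := by
    rw [(degreeLTEquiv ℝ N).finrank_eq]; simp
  have : CompleteSpace (degreeLT ℝ N) := FiniteDimensional.complete ℝ _
  -- The compression of multiplication by `X` is defined through Riesz representation: `T f`
  -- represents `g ↦ L (X * f * g)`.
  let φ : degreeLT ℝ N → (degreeLT ℝ N →ₗ[ℝ] ℝ) := fun f =>
    L ∘ₗ LinearMap.mulLeft ℝ (X * f.1) ∘ₗ (degreeLT ℝ N).subtype
  let T' : degreeLT ℝ N → degreeLT ℝ N := fun f =>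
    (InnerProductSpace.toDual ℝ (degreeLT ℝ N)).symm (LinearMap.toContinuousLinearMap (φ f))
  have hT' : ∀ f g, inner ℝ (T' f) g = L (X * f.1 * g.1) := fun f g => by
    simp only [T', InnerProductSpace.toDual_symm_apply]
    rfl
  let T : degreeLT ℝ N →ₗ[ℝ] degreeLT ℝ N :=
    { toFun := T'
      map_add' := fun f g => ext_inner_right ℝ fun h => by
        rw [inner_add_left, hT', hT', hT']; simp [mul_add, add_mul]
      map_smul' := fun r f => ext_inner_right ℝ fun h => by
        rw [RingHom.id_apply, inner_smul_left, hT', hT']; simp }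
  have hT : ∀ f g, inner ℝ (T f) g = L (X * f.1 * g.1) := hT'
  have hsymm : T.IsSymmetric := fun f g => by
    rw [hT, real_inner_comm, hT]; congr 1; ring
  let v := hsymm.eigenvectorBasis hrank
  let t := hsymm.eigenvalues hrank
  have hv : ∀ i, T (v i) = t i • v i := fun i => hsymm.apply_eigenvectorBasis hrank i
  have one_mem : (1 : ℝ[X]) ∈ degreeLT ℝ N := by
    rw [mem_degreeLT]; exact degree_one_le.trans_lt (by exact_mod_cast hN)
  let e : degreeLT ℝ N := ⟨1, one_mem⟩
  -- As long as the degree stays below `N`, multiplication by `X` does not leave the space and the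
  -- compression changes nothing.
  have hpow : ∀ k < N, ((T ^ k) e).1 = X ^ k := by
    intro k
    induction k with
    | zero => intro _; simp [e]
    | succ k ih =>
      intro hk
      have hmem : (X : ℝ[X]) ^ (k + 1) ∈ degreeLT ℝ N := by
        rw [mem_degreeLT, degree_X_pow]; exact_mod_cast hk
      have : (T ^ (k + 1)) e = ⟨X ^ (k + 1), hmem⟩ := by
        refine ext_inner_right ℝ fun g => ?_
        rw [pow_succ', Module.End.mul_apply, hT, ih (by omega), hinner, ← pow_succ']
      rw [this]
  have hTv : ∀ k i, inner ℝ ((T ^ k) e) (v i) = t i ^ k * inner ℝ e (v i) := by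
    intro k i
    induction k with
    | zero => simp
    | succ k ih =>
      rw [pow_succ', Module.End.mul_apply, hsymm, hv, inner_smul_right, ih]
      ring
  have hexp : ∀ a b, inner ℝ ((T ^ a) e) ((T ^ b) e) =
      ∑ i, inner ℝ e (v i) ^ 2 * t i ^ (a + b) := by
    intro a b
    rw [← v.sum_inner_mul_inner]
    refine Finset.sum_congr rfl fun i _ => ?_
    rw [real_inner_comm ((T ^ b) e), hTv, hTv]
    ring
  -- Nodes are the eigenvalues of `T`, positive as Rayleigh quotients; weights are the squared
  -- coordinates of the polynomial `1` in the eigenbasis.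
  refine ⟨t, fun i => inner ℝ e (v i) ^ 2, fun i => ?_, fun i => sq_nonneg _, fun k hk => ?_⟩
  · have h := hT (v i) (v i)
    have hne : v i ≠ 0 := v.orthonormal.ne_zero i
    rw [hv, inner_smul_left, real_inner_self_eq_norm_sq, v.norm_eq_one] at h
    simp only [conj_trivial, one_pow, mul_one] at h
    rw [h, mul_assoc]
    exact h1 _ (fun h => hne (Subtype.ext h)) (mem_degreeLT.1 (v i).2)
  · rcases Nat.eq_zero_or_pos k with rfl | hk0
    · have := hexp 0 0
      rw [hinner] at this
      simpa [e] using this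
    -- One factor `T` is set aside to become the `X` in `hT`; the other `k - 1 ≤ 2 * N - 2` are
    -- split into two exponents below `N`. This reaches degree `2 * N - 1`.
    · have := hexp ((k - 1) / 2 + 1) (k - 1 - (k - 1) / 2)
      rw [show (k - 1) / 2 + 1 + (k - 1 - (k - 1) / 2) = k by omega] at this
      rw [← this, pow_succ', Module.End.mul_apply, hT, hpow _ (by omega), hpow _ (by omega),
        mul_assoc, ← pow_add, ← pow_succ']
      congr 2
      omega

open Polynomial Finset in
/-- The functional on polynomials with moments `(a)_n (b)_{P-n}` for `n ≤ P`. -/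
noncomputable def pochhammerFunctional (a b : ℝ) (P : ℕ) : ℝ[X] →ₗ[ℝ] ℝ :=
  ∑ n ∈ range (P + 1), ((ascPochhammer ℝ n).eval a * (ascPochhammer ℝ (P - n)).eval b) • lcoeff ℝ n

open Polynomial Finset in
theorem pochhammerFunctional_apply (a b : ℝ) (P : ℕ) (f : ℝ[X]) :
    pochhammerFunctional a b P f = ∑ n ∈ range (P + 1), f.coeff n *
      ((ascPochhammer ℝ n).eval a * (ascPochhammer ℝ (P - n)).eval b) := by
  simp [pochhammerFunctional, mul_comm]

open Polynomial Finset in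
theorem pochhammerFunctional_X_pow (a b : ℝ) {P n : ℕ} (hn : n ≤ P) :
    pochhammerFunctional a b P (X ^ n) =
      (ascPochhammer ℝ n).eval a * (ascPochhammer ℝ (P - n)).eval b := by
  rw [pochhammerFunctional_apply, sum_eq_single n]
  · simp
  · intro k _ hk
    simp [coeff_X_pow, hk]
  · intro h
    exact absurd (mem_range.2 (Nat.lt_succ_of_le hn)) h

open Polynomial Finset in
theorem pochhammerFunctional_pos {a b : ℝ} (ha : 0 < a) (hb : 0 < b) {P : ℕ} {f : ℝ[X]}
    (hf : f ≠ 0) (hdeg : f.natDegree ≤ P) (hpos : ∀ t : ℝ, 0 < t → 0 ≤ f.eval t) :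
    0 < pochhammerFunctional a b P f := by
  rw [pochhammerFunctional_apply]
  exact sum_coeff_mul_ascPochhammer_pos ha hb hf hdeg hpos

-- For `g` of degree below `N`, both `g²` and `X g²` have degree at most `2 * N - 1 = P`, which is
-- where the functional is known to be positive; Gauss quadrature then matches all `P + 1` moments.
open Polynomial in
theorem exists_quadrature_odd {a b : ℝ} (ha : 0 < a) (hb : 0 < b) {N P : ℕ} (hP : P + 1 = 2 * N) :
    ∃ t w : Fin N → ℝ, (∀ i, 0 < t i) ∧ (∀ i, 0 ≤ w i) ∧ ∀ n ≤ P, ∑ i, w i * t i ^ n =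
      (ascPochhammer ℝ n).eval a * (ascPochhammer ℝ (P - n)).eval b := by
  have hd : ∀ g : ℝ[X], g ≠ 0 → g.degree < N → g.natDegree < N := fun g hg h =>
    (natDegree_lt_iff_degree_lt hg).2 h
  have hA : ∀ g : ℝ[X], g ≠ 0 → g.degree < N → 0 < pochhammerFunctional a b P (g * g) := by
    intro g hg hN
    have := hd g hg hN
    refine pochhammerFunctional_pos ha hb (mul_ne_zero hg hg) ?_ fun t _ => ?_
    · rw [natDegree_mul hg hg]; omega
    · rw [eval_mul]; exact mul_self_nonneg _
  have hB : ∀ g : ℝ[X], g ≠ 0 → g.degree < N →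
      0 < pochhammerFunctional a b P (X * (g * g)) := by
    intro g hg hN
    have := hd g hg hN
    refine pochhammerFunctional_pos ha hb (mul_ne_zero X_ne_zero (mul_ne_zero hg hg)) ?_
      fun t ht => ?_
    · rw [natDegree_mul X_ne_zero (mul_ne_zero hg hg), natDegree_mul hg hg, natDegree_X]; omega
    · rw [eval_mul, eval_mul, eval_X]; exact mul_nonneg ht.le (mul_self_nonneg _)
  obtain ⟨t, w, ht, hw, h⟩ := exists_gauss_quadrature (by omega) _ hA hB
  refine ⟨t, w, ht, hw, fun n hn => ?_⟩
  rw [← h n (by omega), pochhammerFunctional_X_pow a b hn]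

open Polynomial in
/-- Gauss–Radau quadrature: one of the nodes is `0`. -/
theorem exists_quadrature_even {a b : ℝ} (ha : 0 < a) (hb : 0 < b) {N P : ℕ} (hN : 0 < N)
    (hP : P = 2 * N) :
    ∃ (w₀ : ℝ) (t w : Fin N → ℝ), 0 ≤ w₀ ∧ (∀ i, 0 < t i) ∧ (∀ i, 0 ≤ w i) ∧
      ∀ n ≤ P, w₀ * 0 ^ n + ∑ i, w i * t i ^ n =
        (ascPochhammer ℝ n).eval a * (ascPochhammer ℝ (P - n)).eval b := by
  have hd : ∀ g : ℝ[X], g ≠ 0 → g.degree < N → g.natDegree < N := fun g hg h =>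
    (natDegree_lt_iff_degree_lt hg).2 h
  set L := pochhammerFunctional a b P with hL
  -- Gauss quadrature is applied to the measure multiplied by `t`; dividing its weights by `t i`
  -- afterwards recovers the moments of order at least `1`, and the node `0` corrects the moment of
  -- order `0`.
  let L' : ℝ[X] →ₗ[ℝ] ℝ := L ∘ₗ LinearMap.mulLeft ℝ X
  have hL' : ∀ f, L' f = L (X * f) := fun _ => rfl
  have hA : ∀ g : ℝ[X], g ≠ 0 → g.degree < N → 0 < L' (g * g) := by
    intro g hg hN
    have := hd g hg hN
    rw [hL']
    refine pochhammerFunctional_pos ha hb (mul_ne_zero X_ne_zero (mul_ne_zero hg hg)) ?_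
      fun t ht => ?_
    · rw [natDegree_mul X_ne_zero (mul_ne_zero hg hg), natDegree_mul hg hg, natDegree_X]; omega
    · rw [eval_mul, eval_mul, eval_X]; exact mul_nonneg ht.le (mul_self_nonneg _)
  have hB : ∀ g : ℝ[X], g ≠ 0 → g.degree < N → 0 < L' (X * (g * g)) := by
    intro g hg hN
    have := hd g hg hN
    have hX : X * (X * (g * g)) = (X * g) * (X * g) := by ring
    have hXg : X * g ≠ 0 := mul_ne_zero X_ne_zero hg
    rw [hL', hX]
    refine pochhammerFunctional_pos ha hb (mul_ne_zero hXg hXg) ?_ fun t ht => ?_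
    · rw [natDegree_mul hXg hXg, natDegree_mul X_ne_zero hg, natDegree_X]; omega
    · rw [eval_mul]; exact mul_self_nonneg _
  obtain ⟨t, w, ht, hw, h⟩ := exists_gauss_quadrature hN L' hA hB
  have hpoly : ∀ f : ℝ[X], f.natDegree < 2 * N → L' f = ∑ i, w i * f.eval (t i) := by
    intro f hf
    conv_lhs => rw [as_sum_range_C_mul_X_pow' f hf]
    simp_rw [eval_eq_sum_range' hf, Finset.mul_sum]
    rw [map_sum, Finset.sum_comm]
    refine Finset.sum_congr rfl fun k hk => ?_
    rw [← smul_eq_C_mul, map_smul, h k (Finset.mem_range.1 hk), smul_eq_mul, Finset.mul_sum]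
    exact Finset.sum_congr rfl fun i _ => by ring
  -- Test on `Q²`, with `Q` vanishing at all the `t i`: its degree is `2 * N = P`, and `0 < L (Q²)`
  -- equals `Q(0)²` times the weight at `0`.
  have hw0 : 0 ≤ L 1 - ∑ i, w i / t i := by
    let Q : ℝ[X] := ∏ i, (X - C (t i))
    have hQ : Q.Monic := monic_prod_of_monic _ _ fun i _ => monic_X_sub_C _
    have hQd : Q.natDegree = N := by
      rw [natDegree_prod_of_monic _ _ fun i _ => monic_X_sub_C _]; simp
    have hQ2 : (Q * Q).natDegree = 2 * N := by rw [hQ.natDegree_mul hQ, hQd]; ring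
    have hpos : 0 < L (Q * Q) := by
      refine pochhammerFunctional_pos ha hb (mul_ne_zero hQ.ne_zero hQ.ne_zero) ?_ fun t _ => ?_
      · omega
      · rw [eval_mul]; exact mul_self_nonneg _
    have hroot : ∀ i, (Q * Q).eval (t i) = 0 := by
      intro i
      have : Q.eval (t i) = 0 := by
        rw [eval_prod]; exact Finset.prod_eq_zero (Finset.mem_univ i) (by simp)
      rw [eval_mul, this, zero_mul]
    have hdiv := X_mul_divX_add (Q * Q)
    have hdeg : (Q * Q).divX.natDegree < 2 * N := by
      rw [natDegree_divX_eq_natDegree_tsub_one, hQ2]; omega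
    have hev : ∀ i, (Q * Q).divX.eval (t i) = -((Q * Q).coeff 0) / t i := by
      intro i
      have := congrArg (eval (t i)) hdiv
      rw [hroot, eval_add, eval_mul, eval_X, eval_C] at this
      rw [eq_div_iff (ht i).ne']
      linear_combination this
    rw [← hdiv, map_add, ← hL', hpoly _ hdeg, ← mul_one (C _), ← smul_eq_C_mul, map_smul] at hpos
    simp_rw [hev] at hpos
    have hc : 0 ≤ (Q * Q).coeff 0 := by
      rw [mul_coeff_zero]; exact mul_self_nonneg _
    have : 0 < (Q * Q).coeff 0 * (L 1 - ∑ i, w i / t i) := by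
      convert hpos using 1
      rw [mul_sub, Finset.mul_sum, smul_eq_mul, add_comm, sub_eq_add_neg,
        ← Finset.sum_neg_distrib]
      congr 1
      exact Finset.sum_congr rfl fun i _ => by ring
    exact (pos_of_mul_pos_right this hc).le
  refine ⟨L 1 - ∑ i, w i / t i, t, fun i => w i / t i, hw0, ht,
    fun i => div_nonneg (hw i) (ht i).le, fun n hn => ?_⟩
  rw [← pochhammerFunctional_X_pow a b hn, ← hL]
  rcases n with _ | n
  · simp
  · rw [pow_succ' X n, ← hL', h n (by omega), zero_pow (Nat.succ_ne_zero n), mul_zero, zero_add]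
    refine Finset.sum_congr rfl fun i _ => ?_
    have := (ht i).ne'
    rw [pow_succ]
    field_simp

/-! ### Cubature formulas and designs in real Euclidean spaces -/

/-- `∑ ⟪a i, x⟫ ^ q = ‖x‖ ^ q`: an isometric embedding of a Euclidean space into `ℓ_q`. -/
def IsCubature {E ι : Type*} [NormedAddCommGroup E] [InnerProductSpace ℝ E] [Fintype ι]
    (q : ℕ) (a : ι → E) : Prop :=
  ∀ x : E, ∑ i, inner ℝ (a i) x ^ q = ‖x‖ ^ q

/-- A weighted projective spherical design: a positive quadrature on the unit sphere of a
`d`-dimensional Euclidean space which is exact for even forms of degree at most `2 * r`. -/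
structure IsDesign {E ι : Type*} [NormedAddCommGroup E] [InnerProductSpace ℝ E] [Fintype ι]
    (r : ℕ) (A : ι → ℝ) (θ : ι → E) : Prop where
  nonneg : ∀ i, 0 ≤ A i
  norm_eq_one : ∀ i, ‖θ i‖ = 1
  sum_eq : ∀ j ≤ r, ∀ x : E, ∑ i, A i * inner ℝ (θ i) x ^ (2 * j) =
    sphereMoment (Module.finrank ℝ E) j * ‖x‖ ^ (2 * j)

section

variable {E ι : Type*} [NormedAddCommGroup E] [InnerProductSpace ℝ E] [Fintype ι]

theorem hasDerivAt_norm_sq_add_smul (x e : E) (t : ℝ) :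
    HasDerivAt (fun s : ℝ => ‖x + s • e‖ ^ 2) (2 * inner ℝ (x + t • e) e) t := by
  have h : HasDerivAt (fun s : ℝ => x + s • e) e t := by
    simpa using ((hasDerivAt_id t).smul_const e).const_add x
  exact h.norm_sq

theorem hasDerivAt_inner_add_smul (a x e : E) (t : ℝ) :
    HasDerivAt (fun s : ℝ => inner ℝ a (x + s • e)) (inner ℝ a e) t := by
  have : (fun s : ℝ => (inner ℝ a (x + s • e) : ℝ)) =
      fun s => inner ℝ a x + s * inner ℝ a e := by
    funext s; rw [inner_add_right, inner_smul_right]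
  rw [this]
  simpa using ((hasDerivAt_id t).mul_const (inner ℝ a e : ℝ)).const_add (inner ℝ a x : ℝ)

/-- Applying the Laplacian to `∑ w i * ⟪a i, x⟫ ^ (2 * j + 2) = C * ‖x‖ ^ (2 * j + 2)`. -/
theorem sum_norm_sq_mul_inner_pow [FiniteDimensional ℝ E] {w : ι → ℝ} {a : ι → E} {C : ℝ} {j : ℕ}
    (h : ∀ x : E, ∑ i, w i * inner ℝ (a i) x ^ (2 * (j + 1)) = C * ‖x‖ ^ (2 * (j + 1))) (x : E) :
    (2 * j + 1) * ∑ i, w i * ‖a i‖ ^ 2 * inner ℝ (a i) x ^ (2 * j) =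
      C * (Module.finrank ℝ E + 2 * j) * ‖x‖ ^ (2 * j) := by
  have h1 : ∀ x e : E, ∑ i, w i * (inner ℝ (a i) x ^ (2 * j + 1) * inner ℝ (a i) e) =
      C * ((‖x‖ ^ 2) ^ j * inner ℝ x e) := by
    intro x e
    have hl : HasDerivAt (fun t : ℝ => ∑ i, w i * inner ℝ (a i) (x + t • e) ^ (2 * (j + 1)))
        (∑ i, w i * ((2 * (j + 1) : ℕ) * inner ℝ (a i) (x + (0 : ℝ) • e) ^ (2 * (j + 1) - 1) *
          inner ℝ (a i) e)) 0 :=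
      HasDerivAt.fun_sum fun i _ =>
        ((hasDerivAt_inner_add_smul (a i) x e 0).fun_pow (2 * (j + 1))).const_mul (w i)
    have hr : HasDerivAt (fun t : ℝ => C * (‖x + t • e‖ ^ 2) ^ (j + 1))
        (C * ((j + 1 : ℕ) * (‖x + (0 : ℝ) • e‖ ^ 2) ^ (j + 1 - 1) *
          (2 * inner ℝ (x + (0 : ℝ) • e) e))) 0 :=
      ((hasDerivAt_norm_sq_add_smul x e 0).fun_pow (j + 1)).const_mul C
    have heq : (fun t : ℝ => ∑ i, w i * (inner ℝ (a i) (x + t • e) : ℝ) ^ (2 * (j + 1))) =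
        fun t : ℝ => C * (‖x + t • e‖ ^ 2) ^ (j + 1) := by
      funext t; rw [h, ← pow_mul]
    rw [heq] at hl
    have := hl.unique hr
    simp only [zero_smul, add_zero, Nat.add_sub_cancel] at this
    rw [show 2 * (j + 1) - 1 = 2 * j + 1 by omega] at this
    have hj : ((2 * (j + 1) : ℕ) : ℝ) ≠ 0 := by positivity
    apply mul_left_cancel₀ hj
    rw [Finset.mul_sum]
    calc _ = _ := Finset.sum_congr rfl fun i _ => by ring
      _ = _ := this
      _ = _ := by push_cast; ring
  -- Second derivative in the direction `e`; for `j = 0` the truncated exponent `j - 1` is harmless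
  -- because of the factor `2 * j`.
  have h2 : ∀ e : E, ∑ i, w i * ((2 * j + 1) * inner ℝ (a i) x ^ (2 * j) * inner ℝ (a i) e ^ 2) =
      C * (2 * j * (‖x‖ ^ 2) ^ (j - 1) * inner ℝ x e ^ 2 + (‖x‖ ^ 2) ^ j * ‖e‖ ^ 2) := by
    intro e
    have hl : HasDerivAt (fun t : ℝ => ∑ i, w i * (inner ℝ (a i) (x + t • e) ^ (2 * j + 1) *
          inner ℝ (a i) e))
        (∑ i, w i * ((2 * j + 1 : ℕ) * inner ℝ (a i) (x + (0 : ℝ) • e) ^ (2 * j + 1 - 1) *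
          inner ℝ (a i) e * inner ℝ (a i) e)) 0 :=
      HasDerivAt.fun_sum fun i _ =>
        (((hasDerivAt_inner_add_smul (a i) x e 0).fun_pow (2 * j + 1)).mul_const _).const_mul (w i)
    have hin : HasDerivAt (fun t : ℝ => (inner ℝ (x + t • e) e : ℝ)) (inner ℝ e e) 0 := by
      simpa only [real_inner_comm] using hasDerivAt_inner_add_smul e x e 0
    have hr : HasDerivAt (fun t : ℝ => C * ((‖x + t • e‖ ^ 2) ^ j * inner ℝ (x + t • e) e))
        (C * ((j * (‖x + (0 : ℝ) • e‖ ^ 2) ^ (j - 1) * (2 * inner ℝ (x + (0 : ℝ) • e) e)) *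
          inner ℝ (x + (0 : ℝ) • e) e + (‖x + (0 : ℝ) • e‖ ^ 2) ^ j * inner ℝ e e)) 0 :=
      (((hasDerivAt_norm_sq_add_smul x e 0).fun_pow j).fun_mul hin).const_mul C
    simp_rw [h1] at hl
    have := hl.unique hr
    simp only [zero_smul, add_zero, Nat.add_sub_cancel] at this
    rw [real_inner_self_eq_norm_sq] at this
    calc _ = _ := Finset.sum_congr rfl fun i _ => by push_cast; ring
      _ = _ := this
      _ = _ := by ring
  -- Summing second derivatives over an orthonormal basis gives the Laplacian.
  let b := stdOrthonormalBasis ℝ E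
  have h3 := Finset.sum_congr (s₁ := Finset.univ) rfl fun k _ => h2 (b k)
  rw [Finset.sum_comm, ← Finset.mul_sum, Finset.sum_add_distrib, ← Finset.mul_sum,
    ← Finset.mul_sum] at h3
  simp only [b.sum_sq_inner_left, b.norm_eq_one, one_pow, Finset.sum_const, Finset.card_univ,
    Fintype.card_fin, nsmul_eq_mul, mul_one] at h3
  simp_rw [← Finset.mul_sum, b.sum_sq_inner_left] at h3
  rw [Finset.mul_sum]
  calc _ = _ := Finset.sum_congr rfl fun i _ => by ring
    _ = _ := h3
    _ = _ := by
      rcases j with _ | j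
      · simp
      · rw [Nat.add_sub_cancel]; push_cast; ring

/-- Each Laplacian lowers the degree by two and moves a factor `‖a i‖ ^ 2` into the weight.
Normalizing the vectors then gives one set of weights valid in every degree `2 * j ≤ 2 * r`. -/
theorem IsCubature.exists_isDesign [FiniteDimensional ℝ E] [Nontrivial E] {r : ℕ} (hr : 0 < r)
    {a : ι → E} (h : IsCubature (2 * r) a) : ∃ (A : ι → ℝ) (θ : ι → E), IsDesign r A θ := by
  have hd : 0 < Module.finrank ℝ E := Module.finrank_pos
  have key : ∀ k ≤ r, ∀ x : E, ∑ i, ‖a i‖ ^ (2 * k) * inner ℝ (a i) x ^ (2 * (r - k)) =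
      sphereMoment (Module.finrank ℝ E) (r - k) / sphereMoment (Module.finrank ℝ E) r *
        ‖x‖ ^ (2 * (r - k)) := by
    intro k
    induction k with
    | zero =>
      intro _ x
      simpa [div_self (sphereMoment_pos hd r).ne'] using h x
    | succ k ih =>
      intro hk x
      obtain ⟨j, rfl⟩ : ∃ j, r = j + 1 + k := ⟨r - (k + 1), by omega⟩
      have := ih (by omega)
      rw [Nat.add_sub_cancel] at this
      have := sum_norm_sq_mul_inner_pow this x
      rw [show j + 1 + k - (k + 1) = j by omega]
      rw [sphereMoment_succ] at this
      have h1 : (2 * j + 1 : ℝ) ≠ 0 := by positivity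
      have h2 : (Module.finrank ℝ E + 2 * j : ℝ) ≠ 0 := by positivity
      apply mul_left_cancel₀ h1
      calc _ = (2 * j + 1) * ∑ i, ‖a i‖ ^ (2 * k) * ‖a i‖ ^ 2 * inner ℝ (a i) x ^ (2 * j) := by
            congr 1; exact Finset.sum_congr rfl fun i _ => by ring
        _ = _ := this
        _ = _ := by
          have h3 := (sphereMoment_pos hd (j + 1 + k)).ne'
          field_simp
  -- A zero vector gets an arbitrary unit direction `u`; its weight `‖a i‖ ^ (2 * r)` is zero since
  -- `0 < r`.
  obtain ⟨u, hu⟩ := exists_norm_eq E zero_le_one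
  classical
  refine ⟨fun i => sphereMoment (Module.finrank ℝ E) r * ‖a i‖ ^ (2 * r),
    fun i => if a i = 0 then u else ‖a i‖⁻¹ • a i, ⟨fun i => ?_, fun i => ?_, fun j hj x => ?_⟩⟩
  · have := (sphereMoment_pos hd r).le
    positivity
  · split_ifs with hi
    · exact hu
    · exact norm_smul_inv_norm hi
  · have hk := key (r - j) (by omega) x
    rw [show r - (r - j) = j by omega] at hk
    have h0 := (sphereMoment_pos hd r).ne'
    calc _ = sphereMoment (Module.finrank ℝ E) r *
          ∑ i, ‖a i‖ ^ (2 * (r - j)) * inner ℝ (a i) x ^ (2 * j) := by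
          rw [Finset.mul_sum]
          refine Finset.sum_congr rfl fun i _ => ?_
          split_ifs with hi
          · rcases Nat.eq_zero_or_pos j with rfl | hj0
            · simp [hi]
            · simp [hi, hr.ne', hj0.ne']
          · have hn : ‖a i‖ ≠ 0 := norm_ne_zero_iff.2 hi
            rw [real_inner_smul_left, mul_pow,
              show 2 * r = 2 * (r - j) + 2 * j by omega, pow_add, inv_pow]
            field_simp
      _ = _ := by rw [hk]; field_simp

theorem IsCubature.of_linearIsometryEquiv {F : Type*} [NormedAddCommGroup F]
    [InnerProductSpace ℝ F] (e : E ≃ₗᵢ[ℝ] F) {q : ℕ} {a : ι → E} (h : IsCubature q a) :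
    IsCubature q fun i => e (a i) := by
  intro x
  rw [← e.symm.norm_map, ← h]
  refine Finset.sum_congr rfl fun i _ => ?_
  rw [← e.symm.inner_map_map, e.symm_apply_apply]

theorem IsCubature.exists_of_finrank_eq [FiniteDimensional ℝ E] {F : Type*} [NormedAddCommGroup F]
    [InnerProductSpace ℝ F] [FiniteDimensional ℝ F]
    (hEF : Module.finrank ℝ E = Module.finrank ℝ F) {q : ℕ} {a : ι → E} (h : IsCubature q a) :
    ∃ b : ι → F, IsCubature q b :=
  ⟨_, h.of_linearIsometryEquiv
    ((stdOrthonormalBasis ℝ E).equiv (stdOrthonormalBasis ℝ F) (finCongr hEF))⟩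

end

/-! ### Averaging over designs in a normed division ring -/

open Finset in
theorem add_pow_add_sub_pow (X Y : ℝ) (P : ℕ) :
    (X + Y) ^ P + (X - Y) ^ P =
      2 * ∑ k ∈ range (P / 2 + 1), (P.choose (2 * k) : ℝ) * (Y ^ (2 * k) * X ^ (P - 2 * k)) := by
  rw [add_comm X Y, sub_eq_neg_add, add_pow, add_pow, ← sum_add_distrib]
  have h : ∀ m ∈ range (P + 1), Y ^ m * X ^ (P - m) * (P.choose m : ℝ) +
      (-Y) ^ m * X ^ (P - m) * (P.choose m : ℝ) =
      if Even m then 2 * ((P.choose m : ℝ) * (Y ^ m * X ^ (P - m))) else 0 := by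
    intro m _
    split_ifs with hm
    · rw [hm.neg_pow]; ring
    · rw [(Nat.not_even_iff_odd.1 hm).neg_pow]; ring
  rw [sum_congr rfl h, ← sum_filter, mul_sum]
  symm
  refine sum_bij' (fun k _ => 2 * k) (fun m _ => m / 2) ?_ ?_ ?_ ?_ ?_
  · intro k hk
    simp only [mem_filter, mem_range, even_two_mul, and_true] at hk ⊢
    omega
  · intro m hm
    simp only [mem_filter, mem_range] at hm ⊢
    omega
  · intro k _
    omega
  · intro m hm
    exact Nat.two_mul_div_two_of_even (mem_filter.1 hm).2
  · intro k _
    rfl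

section

variable {F : Type} [NormedDivisionRing F] [InnerProductSpace ℝ F]

/-- Polarization and multiplicativity of the norm; commutativity is not needed, so quaternions are
covered. -/
theorem inner_mul_mul_right (a b c : F) :
    inner ℝ (a * b) (c * b) = ‖b‖ ^ 2 * inner ℝ a c := by
  simp only [real_inner_eq_norm_add_mul_self_sub_norm_mul_self_sub_norm_mul_self_div_two,
    ← add_mul, norm_mul]
  ring

/-- In a normed division ring with a real inner product, right multiplication by `b` is adjoint to
right multiplication by `‖b‖ ^ 2 • b⁻¹`. -/
theorem inner_mul_eq_inner_mul_smul_inv [SMulCommClass ℝ F F] (a b z : F) :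
    inner ℝ (a * b) z = inner ℝ a (z * (‖b‖ ^ 2 • b⁻¹)) := by
  by_cases hb : b = 0
  · simp [hb]
  · conv_lhs => rw [← inv_mul_cancel_right₀ hb z]
    rw [mul_smul_comm, inner_smul_right, inner_mul_mul_right]

theorem norm_sq_smul_inv (b : F) : ‖‖b‖ ^ 2 • b⁻¹‖ = ‖b‖ := by
  by_cases hb : b = 0
  · simp [hb]
  · have : ‖b‖ ≠ 0 := norm_ne_zero_iff.2 hb
    rw [norm_smul, norm_inv, norm_pow, norm_norm]
    field_simp

theorem IsDesign.sum_eq_one {E ι : Type*} [NormedAddCommGroup E] [InnerProductSpace ℝ E]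
    [Fintype ι] {r : ℕ} {A : ι → ℝ} {θ : ι → E} (h : IsDesign r A θ) : ∑ i, A i = 1 := by
  simpa [sphereMoment_zero] using h.sum_eq 0 (Nat.zero_le _) 0

variable [SMulCommClass ℝ F F] [FiniteDimensional ℝ F]

-- Expanding `‖θξ ± z‖² = ‖ξ‖² + ‖z‖² ± 2⟪θξ, z⟫`, only even powers of the cross term up to `2⌊P/2⌋`
-- survive. Moving `ξ` to the other side by the adjoint makes each a power of a linear form in `θ`,
-- to which the design applies.
open Finset in
theorem IsDesign.sum_norm_mul_add_pow {ι : Type*} [Fintype ι] {r P : ℕ} (hr : P / 2 ≤ r)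
    {A : ι → ℝ} {θ : ι → F} (h : IsDesign r A θ) (ξ z : F) :
    ∑ i, A i * (‖θ i * ξ + z‖ ^ (2 * P) + ‖θ i * ξ - z‖ ^ (2 * P)) =
    2 * ∑ n ∈ range (P + 1), (P.choose n : ℝ) *
      ((ascPochhammer ℝ P).eval (Module.finrank ℝ F / 2 : ℝ) /
      ((ascPochhammer ℝ n).eval (Module.finrank ℝ F / 2 : ℝ) *
        (ascPochhammer ℝ (P - n)).eval (Module.finrank ℝ F / 2 : ℝ))) *
      ((‖z‖ ^ 2) ^ n * (‖ξ‖ ^ 2) ^ (P - n)) := by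
  rw [← sum_choose_mul_sphereMoment Module.finrank_pos]
  have h1 : ∀ i, A i * (‖θ i * ξ + z‖ ^ (2 * P) + ‖θ i * ξ - z‖ ^ (2 * P)) =
      ∑ k ∈ range (P / 2 + 1), 2 * ((P.choose (2 * k) : ℝ) * 4 ^ k *
        (‖ξ‖ ^ 2 + ‖z‖ ^ 2) ^ (P - 2 * k)) *
        (A i * inner ℝ (θ i) (z * (‖ξ‖ ^ 2 • ξ⁻¹)) ^ (2 * k)) := by
    intro i
    have e1 : ‖θ i * ξ + z‖ ^ 2 = (‖ξ‖ ^ 2 + ‖z‖ ^ 2) + 2 * inner ℝ (θ i * ξ) z := by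
      rw [norm_add_sq_real, norm_mul, h.norm_eq_one]; ring
    have e2 : ‖θ i * ξ - z‖ ^ 2 = (‖ξ‖ ^ 2 + ‖z‖ ^ 2) - 2 * inner ℝ (θ i * ξ) z := by
      rw [norm_sub_sq_real, norm_mul, h.norm_eq_one]; ring
    rw [pow_mul, pow_mul, e1, e2, add_pow_add_sub_pow, mul_sum, mul_sum,
      inner_mul_eq_inner_mul_smul_inv]
    refine sum_congr rfl fun k _ => ?_
    rw [mul_pow, pow_mul 2 2 k]
    ring
  rw [sum_congr rfl fun i _ => h1 i, sum_comm, mul_sum]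
  refine sum_congr rfl fun k hk => ?_
  rw [← mul_sum, h.sum_eq k (by rw [mem_range] at hk; omega), norm_mul, norm_sq_smul_inv,
    mul_pow, pow_mul, pow_mul, mul_pow]
  ring

/-- A power `‖z‖ ^ (2 * n)` is, up to a moment, the average of `⟪b i, z⟫ ^ (2 * n)`. For `z = ∑ w_l
y_l` this inner product equals `⟪w, y' i⟫` with `‖y' i‖ = ‖y‖`, so the real design `w` evaluates it.
The family `b` serves only this argument. -/
theorem IsDesign.sum_norm_sum_mul_pow {ι κ : Type*} [Fintype ι] [Fintype κ] {m P : ℕ}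
    {B : κ → ℝ} {b : κ → F} (hb : IsDesign P B b) {W : ι → ℝ}
    {w : ι → PiLp 2 (fun _ : Fin m => F)} (hw : IsDesign P W w) {n : ℕ} (hn : n ≤ P)
    (y : PiLp 2 (fun _ : Fin m => F)) :
    ∑ j, W j * ‖∑ l, w j l * y l‖ ^ (2 * n) =
      sphereMoment (Module.finrank ℝ (PiLp 2 (fun _ : Fin m => F))) n /
        sphereMoment (Module.finrank ℝ F) n * ‖y‖ ^ (2 * n) := by
  have h0 := (sphereMoment_pos (Module.finrank_pos (R := ℝ) (M := F)) n).ne'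
  let y' : κ → PiLp 2 (fun _ : Fin m => F) := fun i =>
    WithLp.toLp 2 fun l => b i * (‖y l‖ ^ 2 • (y l)⁻¹)
  have hy' : ∀ i, ‖y' i‖ = ‖y‖ := by
    intro i
    rw [PiLp.norm_eq_of_L2, PiLp.norm_eq_of_L2]
    simp only [y', norm_mul, hb.norm_eq_one, one_mul, norm_sq_smul_inv]
  have hin : ∀ i j, inner ℝ (b i) (∑ l, w j l * y l) = inner ℝ (w j) (y' i) := by
    intro i j
    rw [PiLp.inner_apply, inner_sum]
    refine Finset.sum_congr rfl fun l _ => ?_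
    rw [real_inner_comm, inner_mul_eq_inner_mul_smul_inv]
  rw [div_mul_eq_mul_div, eq_div_iff h0, Finset.sum_mul]
  calc _ = ∑ j, ∑ i, B i * (W j * inner ℝ (w j) (y' i) ^ (2 * n)) := by
        refine Finset.sum_congr rfl fun j _ => ?_
        rw [mul_assoc, mul_comm (‖_‖ ^ _), ← hb.sum_eq n hn, Finset.mul_sum]
        refine Finset.sum_congr rfl fun i _ => ?_
        rw [hin]
        ring
    _ = _ := by
        rw [Finset.sum_comm]
        simp_rw [← Finset.mul_sum, hw.sum_eq n hn, hy', ← Finset.sum_mul, hb.sum_eq_one, one_mul]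

end

/-! ### Quadrature identities and isometric embeddings -/

section

variable {F : Type} [NormedRing F]

theorem EllSpace.norm_pow {n q : ℕ} (hq : 0 < q) (x : EllSpace F n q) :
    ‖x‖ ^ q = ∑ i, ‖x i‖ ^ q := by
  have hq' : (0 : ℝ) < q := by exact_mod_cast hq
  rw [PiLp.norm_eq_sum (by simpa using hq')]
  simp only [ENNReal.toReal_natCast, Real.rpow_natCast, one_div]
  exact Real.rpow_inv_natCast_pow (by positivity) hq.ne'

theorem EllSpace.norm_nonneg {n q : ℕ} (hq : 0 < q) (x : EllSpace F n q) : 0 ≤ ‖x‖ := by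
  have hq' : (0 : ℝ) < q := by exact_mod_cast hq
  rw [PiLp.norm_eq_sum (by simpa using hq')]
  positivity

theorem EllSpace.norm_two_mul_pow {n P : ℕ} (x : EllSpace F n 2) :
    ‖x‖ ^ (2 * P) = (∑ i, ‖x i‖ ^ 2) ^ P := by
  rw [pow_mul, EllSpace.norm_pow two_pos]

/-- A positive quadrature formula yields an isometric embedding. -/
theorem HasIsometricEmbedding.of_sum_eq [NormedSpace ℝ F] [IsScalarTower ℝ F F] {ι : Type*}
    [Fintype ι] {m P : ℕ} (hP : 0 < P) {c : ι → Fin m → F} {w : ι → ℝ} (hw : ∀ i, 0 ≤ w i)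
    {C : ℝ} (hC : 0 < C) (h : ∀ x : Fin m → F,
      ∑ i, w i * ‖∑ l, c i l * x l‖ ^ (2 * P) = C * (∑ l, ‖x l‖ ^ 2) ^ P) :
    HasIsometricEmbedding F m (2 * P) (Fintype.card ι) := by
  have hP2 : 2 * P ≠ 0 := by omega
  let e := (Fintype.equivFin ι).symm
  -- The weights are absorbed into the linear forms as real factors, by taking `2 * P`-th roots.
  let s : ι → ℝ := fun i => (w i / C) ^ (((2 * P : ℕ) : ℝ)⁻¹)
  have hs : ∀ i, 0 ≤ s i := fun i => Real.rpow_nonneg (div_nonneg (hw i) hC.le) _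
  have hsp : ∀ i, s i ^ (2 * P) = w i / C := fun i =>
    Real.rpow_inv_natCast_pow (div_nonneg (hw i) hC.le) hP2
  refine ⟨{ toFun := fun x => WithLp.toLp _ fun k => s (e k) • ∑ l, c (e k) l * x l
            map_add' := fun x y => ?_
            map_smul' := fun r x => ?_ }, fun y => ?_⟩
  · ext k
    simp [mul_add, Finset.sum_add_distrib, smul_add]
  · ext k
    simp [MulOpposite.smul_eq_mul_unop, Finset.sum_mul, mul_assoc, smul_mul_assoc]
  · rw [← pow_left_inj₀ (EllSpace.norm_nonneg (by omega) _) (EllSpace.norm_nonneg two_pos _) hP2,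
      EllSpace.norm_pow (by omega), EllSpace.norm_two_mul_pow]
    apply mul_left_cancel₀ hC.ne'
    rw [← h fun l => y l, Finset.mul_sum, ← e.sum_comp]
    refine Finset.sum_congr rfl fun k _ => ?_
    simp only [LinearMap.coe_mk, AddHom.coe_mk]
    rw [norm_smul, mul_pow, Real.norm_of_nonneg (hs _), hsp]
    field_simp

theorem HasIsometricEmbedding.exists_isCubature {d n q : ℕ} (hq : Even q) (hq0 : 0 < q)
    (h : HasIsometricEmbedding ℝ d q n) :
    ∃ a : Fin n → EuclideanSpace ℝ (Fin d), IsCubature q a := by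
  obtain ⟨f, hf⟩ := h
  refine ⟨fun i => WithLp.toLp 2 fun l => f (WithLp.toLp _ (Pi.single l 1)) i, fun x => ?_⟩
  let x' : EllSpace ℝ d 2 := WithLp.toLp _ fun l => x l
  have hx : x' = ∑ l, MulOpposite.op (x l) • WithLp.toLp _ (Pi.single l (1 : ℝ)) := by
    ext k
    simp [x', Finset.sum_apply, Pi.single_apply]
  have hn : ‖x'‖ = ‖x‖ := by
    rw [← pow_left_inj₀ (EllSpace.norm_nonneg two_pos _) (norm_nonneg _) two_ne_zero,
      EllSpace.norm_pow two_pos, EuclideanSpace.norm_sq_eq]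
  rw [← hn, ← hf, EllSpace.norm_pow hq0]
  refine Finset.sum_congr rfl fun i _ => ?_
  rw [Real.norm_eq_abs, hq.pow_abs]
  congr 1
  rw [hx, map_sum]
  simp [PiLp.inner_apply]

end

/-! ### The product construction -/

theorem finrank_piLp_two (F : Type) [NormedDivisionRing F] [InnerProductSpace ℝ F]
    [FiniteDimensional ℝ F] (m : ℕ) :
    Module.finrank ℝ (PiLp 2 (fun _ : Fin m => F)) = m * Module.finrank ℝ F := by
  rw [(WithLp.linearEquiv 2 ℝ (Fin m → F)).finrank_eq, Module.finrank_pi_fintype]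
  simp

section

variable {F : Type} [NormedDivisionRing F] [InnerProductSpace ℝ F] [SMulCommClass ℝ F F]
  [IsScalarTower ℝ F F] [FiniteDimensional ℝ F]

open Finset in
theorem IsDesign.sum_sum_norm_mul_add_pow {ι κ ν : Type*} [Fintype ι] [Fintype κ] [Fintype ν]
    {m r P : ℕ} (hm : 0 < m) (hr : P / 2 ≤ r) {A : ι → ℝ} {θ : ι → F} (hθ : IsDesign r A θ)
    {B : κ → ℝ} {b : κ → F} (hb : IsDesign P B b)
    {W : ν → ℝ} {w : ν → PiLp 2 (fun _ : Fin m => F)} (hw : IsDesign P W w)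
    {t : ℝ} (ht : 0 ≤ t) (ξ : F) (y : PiLp 2 (fun _ : Fin m => F)) :
    ∑ i, ∑ j, A i * W j * (‖θ i * ξ + ∑ l, (√t • w j l) * y l‖ ^ (2 * P) +
      ‖θ i * ξ + ∑ l, (-√t • w j l) * y l‖ ^ (2 * P)) =
    2 * (ascPochhammer ℝ P).eval (Module.finrank ℝ F / 2 : ℝ) *
      ∑ n ∈ range (P + 1), t ^ n * ((P.choose n : ℝ) /
      ((ascPochhammer ℝ n).eval ((m * Module.finrank ℝ F : ℕ) / 2 : ℝ) *
        (ascPochhammer ℝ (P - n)).eval (Module.finrank ℝ F / 2 : ℝ)) *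
      ((‖y‖ ^ 2) ^ n * (‖ξ‖ ^ 2) ^ (P - n))) := by
  have hd : 0 < Module.finrank ℝ F := Module.finrank_pos
  have hD := finrank_piLp_two F m
  have h1 : ∀ j, ∑ i, A i * W j * (‖θ i * ξ + ∑ l, (√t • w j l) * y l‖ ^ (2 * P) +
      ‖θ i * ξ + ∑ l, (-√t • w j l) * y l‖ ^ (2 * P)) =
      ∑ n ∈ range (P + 1), 2 * ((P.choose n : ℝ) *
      ((ascPochhammer ℝ P).eval (Module.finrank ℝ F / 2 : ℝ) /
      ((ascPochhammer ℝ n).eval (Module.finrank ℝ F / 2 : ℝ) *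
        (ascPochhammer ℝ (P - n)).eval (Module.finrank ℝ F / 2 : ℝ))) *
      (t ^ n * (‖ξ‖ ^ 2) ^ (P - n))) * (W j * ‖∑ l, w j l * y l‖ ^ (2 * n)) := by
    intro j
    have h2 := hθ.sum_norm_mul_add_pow hr ξ (√t • ∑ l, w j l * y l)
    simp only [smul_mul_assoc, neg_smul, neg_mul, sum_neg_distrib, ← smul_sum, ← sub_eq_add_neg]
    simp_rw [mul_comm (A _) (W j), mul_assoc (W j), ← mul_sum]
    rw [h2, mul_sum, mul_sum]
    refine sum_congr rfl fun n _ => ?_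
    rw [norm_smul, mul_pow, Real.norm_of_nonneg (Real.sqrt_nonneg _), Real.sq_sqrt ht, mul_pow,
      ← pow_mul _ 2 n]
    ring
  rw [sum_comm, sum_congr rfl fun j _ => h1 j, sum_comm, mul_sum]
  refine sum_congr rfl fun n hn => ?_
  have hmd : 0 < m * Module.finrank ℝ F := Nat.mul_pos hm hd
  rw [← mul_sum, hb.sum_norm_sum_mul_pow hw (by rw [mem_range] at hn; omega), hD,
    sphereMoment_div hd hmd, pow_mul ‖y‖]
  have e1 := (ascPochhammer_half_pos hd n).ne'
  have e2 := (ascPochhammer_half_pos hd (P - n)).ne'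
  have e3 := (ascPochhammer_half_pos hmd n).ne'
  field_simp

open Finset in
/-- Averaging the radial parameter `t` with a quadrature formula turns the product of designs
into an invariant form. -/
theorem IsDesign.sum_radial {ι κ ν ρ : Type*} [Fintype ι] [Fintype κ] [Fintype ν] [Fintype ρ]
    {m r P : ℕ} (hm : 0 < m) (hr : P / 2 ≤ r) {A : ι → ℝ} {θ : ι → F} (hθ : IsDesign r A θ)
    {B : κ → ℝ} {b : κ → F} (hb : IsDesign P B b)
    {W : ν → ℝ} {w : ν → PiLp 2 (fun _ : Fin m => F)} (hw : IsDesign P W w)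
    {t u : ρ → ℝ} (ht : ∀ i, 0 ≤ t i) {u₀ : ℝ}
    (hu : ∀ n ≤ P, u₀ * 0 ^ n + ∑ i, u i * t i ^ n =
      (ascPochhammer ℝ n).eval ((m * Module.finrank ℝ F : ℕ) / 2 : ℝ) *
        (ascPochhammer ℝ (P - n)).eval (Module.finrank ℝ F / 2 : ℝ))
    (ξ : F) (y : PiLp 2 (fun _ : Fin m => F)) :
    ∑ i, 2 * u₀ * A i * ‖θ i * ξ‖ ^ (2 * P) +
    ∑ k, ∑ i, ∑ j, u k * A i * W j * (‖θ i * ξ + ∑ l, (√(t k) • w j l) * y l‖ ^ (2 * P) +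
      ‖θ i * ξ + ∑ l, (-√(t k) • w j l) * y l‖ ^ (2 * P)) =
    2 * (ascPochhammer ℝ P).eval (Module.finrank ℝ F / 2 : ℝ) * (‖ξ‖ ^ 2 + ‖y‖ ^ 2) ^ P := by
  have hd : 0 < Module.finrank ℝ F := Module.finrank_pos
  have hmd : 0 < m * Module.finrank ℝ F := Nat.mul_pos hm hd
  set c : ℕ → ℝ := fun n => (P.choose n : ℝ) /
      ((ascPochhammer ℝ n).eval ((m * Module.finrank ℝ F : ℕ) / 2 : ℝ) *
        (ascPochhammer ℝ (P - n)).eval (Module.finrank ℝ F / 2 : ℝ)) *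
      ((‖y‖ ^ 2) ^ n * (‖ξ‖ ^ 2) ^ (P - n)) with hc
  have h0 : ∑ i, 2 * u₀ * A i * ‖θ i * ξ‖ ^ (2 * P) =
      2 * (ascPochhammer ℝ P).eval (Module.finrank ℝ F / 2 : ℝ) *
        (u₀ * ∑ n ∈ range (P + 1), 0 ^ n * c n) := by
    have : ∑ n ∈ range (P + 1), 0 ^ n * c n = c 0 := by
      rw [sum_range_succ']; simp
    rw [this, hc]
    have e := (ascPochhammer_half_pos hd P).ne'
    simp only [norm_mul, hθ.norm_eq_one, one_mul, ← sum_mul, ← mul_sum, hθ.sum_eq_one]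
    simp only [Nat.choose_zero_right, ascPochhammer_zero, Polynomial.eval_one, Nat.sub_zero,
      pow_zero, pow_mul]
    push_cast
    field_simp
  have h1 : ∀ k, ∑ i, ∑ j, u k * A i * W j *
      (‖θ i * ξ + ∑ l, (√(t k) • w j l) * y l‖ ^ (2 * P) +
        ‖θ i * ξ + ∑ l, (-√(t k) • w j l) * y l‖ ^ (2 * P)) =
      2 * (ascPochhammer ℝ P).eval (Module.finrank ℝ F / 2 : ℝ) *
        ∑ n ∈ range (P + 1), u k * t k ^ n * c n := by
    intro k
    simp_rw [mul_assoc (u k), ← mul_sum]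
    rw [hθ.sum_sum_norm_mul_add_pow hm hr hb hw (ht k)]
    ring
  rw [h0, sum_congr rfl fun k _ => h1 k, ← mul_sum, ← mul_add, sum_comm, mul_sum,
    ← sum_add_distrib, add_comm (‖ξ‖ ^ 2), add_pow]
  congr 1
  -- The prescribed radial moments cancel the Pochhammer denominators of `c n`, leaving the binomial
  -- coefficient.
  refine sum_congr rfl fun n hn => ?_
  rw [← sum_mul, ← mul_assoc, ← add_mul, hu n (Nat.lt_succ_iff.1 (mem_range.1 hn)), hc]
  have e2 := (ascPochhammer_half_pos hd (P - n)).ne'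
  have e3 := (ascPochhammer_half_pos hmd n).ne'
  field_simp

/-- The forms are indexed by `N` radial nodes, `n₁` points of `F`, `n₂` points of `F ^ m` and a
sign, and `2 * N = P + 1`. The cubature in `hF` only justifies the averaging, so its size does not
enter the count. -/
theorem hasIsometricEmbedding_of_isCubature_odd {m r P n₁ n₂ N : ℕ} (hm : 0 < m) (hr : P / 2 ≤ r)
    (hr0 : 0 < r) (hP : P + 1 = 2 * N)
    (hF : ∃ (n : ℕ) (b : Fin n → F), IsCubature (2 * P) b)
    {a : Fin n₁ → F} (ha : IsCubature (2 * r) a)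
    {w : Fin n₂ → PiLp 2 (fun _ : Fin m => F)} (hw : IsCubature (2 * P) w) :
    HasIsometricEmbedding F (m + 1) (2 * P) (n₁ * (P + 1) * n₂) := by
  have hd : 0 < Module.finrank ℝ F := Module.finrank_pos
  have hmd : 0 < m * Module.finrank ℝ F := Nat.mul_pos hm hd
  have hP0 : 0 < P := by omega
  have : Nonempty (Fin m) := ⟨⟨0, hm⟩⟩
  have : Nontrivial (PiLp 2 (fun _ : Fin m => F)) := inferInstance
  obtain ⟨n₃, b, hb⟩ := hF
  obtain ⟨A, θ, hθ⟩ := ha.exists_isDesign hr0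
  obtain ⟨W, ω, hω⟩ := hw.exists_isDesign hP0
  obtain ⟨B, β, hβ⟩ := hb.exists_isDesign hP0
  obtain ⟨t, u, ht, hu, htu⟩ := exists_quadrature_odd
    (a := (m * Module.finrank ℝ F : ℕ) / 2) (b := Module.finrank ℝ F / 2)
    (by positivity) (by positivity) hP
  have key := hθ.sum_radial hm hr hβ hω (fun i => (ht i).le) (u₀ := 0)
    (fun n hn => by rw [zero_mul, zero_add]; exact htu n hn)
  let ε : Bool → ℝ := fun s => bif s then 1 else -1
  have h := HasIsometricEmbedding.of_sum_eq (F := F) (ι := Fin N × Fin n₁ × Fin n₂ × Bool)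
    (m := m + 1) hP0
    (c := fun k => Fin.cons (θ k.2.1) fun l => (ε k.2.2.2 * √(t k.1)) • ω k.2.2.1 l)
    (w := fun k => u k.1 * A k.2.1 * W k.2.2.1)
    (fun k => mul_nonneg (mul_nonneg (hu _) (hθ.nonneg _)) (hω.nonneg _))
    (C := 2 * (ascPochhammer ℝ P).eval (Module.finrank ℝ F / 2 : ℝ))
    (mul_pos two_pos (ascPochhammer_half_pos hd P)) (fun x => by
      have := key (x 0) (WithLp.toLp 2 fun l => x l.succ)
      simp only [mul_zero, zero_mul, Finset.sum_const_zero, zero_add, PiLp.norm_sq_eq_of_L2] at this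
      rw [Fin.sum_univ_succ, ← this]
      simp only [Fintype.sum_prod_type, Fintype.sum_bool, Fin.sum_univ_succ, Fin.cons_zero,
        Fin.cons_succ, ε, cond_true, cond_false, one_mul, neg_one_mul, mul_add])
  convert h using 1
  simp only [Fintype.card_prod, Fintype.card_fin, Fintype.card_bool, hP]
  ring

/-- The node `0` contributes only the `n₁` forms in the first coordinate; the other `N` nodes
contribute `2 * N * n₁ * n₂ = P * n₁ * n₂`. -/
theorem hasIsometricEmbedding_of_isCubature_even {m r P n₁ n₂ N : ℕ} (hm : 0 < m) (hr : P / 2 ≤ r)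
    (hr0 : 0 < r) (hN : 0 < N) (hP : P = 2 * N)
    (hF : ∃ (n : ℕ) (b : Fin n → F), IsCubature (2 * P) b)
    {a : Fin n₁ → F} (ha : IsCubature (2 * r) a)
    {w : Fin n₂ → PiLp 2 (fun _ : Fin m => F)} (hw : IsCubature (2 * P) w) :
    HasIsometricEmbedding F (m + 1) (2 * P) (n₁ * (P * n₂ + 1)) := by
  have hd : 0 < Module.finrank ℝ F := Module.finrank_pos
  have hmd : 0 < m * Module.finrank ℝ F := Nat.mul_pos hm hd
  have hP0 : 0 < P := by omega
  have : Nonempty (Fin m) := ⟨⟨0, hm⟩⟩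
  have : Nontrivial (PiLp 2 (fun _ : Fin m => F)) := inferInstance
  obtain ⟨n₃, b, hb⟩ := hF
  obtain ⟨A, θ, hθ⟩ := ha.exists_isDesign hr0
  obtain ⟨W, ω, hω⟩ := hw.exists_isDesign hP0
  obtain ⟨B, β, hβ⟩ := hb.exists_isDesign hP0
  obtain ⟨u₀, t, u, hu₀, ht, hu, htu⟩ := exists_quadrature_even
    (a := (m * Module.finrank ℝ F : ℕ) / 2) (b := Module.finrank ℝ F / 2)
    (by positivity) (by positivity) hN hP
  have key := hθ.sum_radial hm hr hβ hω (fun i => (ht i).le) htu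
  let ε : Bool → ℝ := fun s => bif s then 1 else -1
  have h := HasIsometricEmbedding.of_sum_eq (F := F)
    (ι := Fin n₁ ⊕ Fin N × Fin n₁ × Fin n₂ × Bool) (m := m + 1) hP0
    (c := Sum.elim (fun i => Fin.cons (θ i) fun _ => 0)
      fun k => Fin.cons (θ k.2.1) fun l => (ε k.2.2.2 * √(t k.1)) • ω k.2.2.1 l)
    (w := Sum.elim (fun i => 2 * u₀ * A i) fun k => u k.1 * A k.2.1 * W k.2.2.1)
    (by
      rintro (i | k)
      · exact mul_nonneg (mul_nonneg zero_le_two hu₀) (hθ.nonneg _)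
      · exact mul_nonneg (mul_nonneg (hu _) (hθ.nonneg _)) (hω.nonneg _))
    (C := 2 * (ascPochhammer ℝ P).eval (Module.finrank ℝ F / 2 : ℝ))
    (mul_pos two_pos (ascPochhammer_half_pos hd P)) (fun x => by
      have := key (x 0) (WithLp.toLp 2 fun l => x l.succ)
      simp only [PiLp.norm_sq_eq_of_L2] at this
      rw [Fin.sum_univ_succ, ← this]
      simp only [Fintype.sum_sum_type, Sum.elim_inl, Sum.elim_inr, Fintype.sum_prod_type,
        Fintype.sum_bool, Fin.sum_univ_succ, Fin.cons_zero, Fin.cons_succ, ε, cond_true,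
        cond_false, one_mul, neg_one_mul, mul_add, zero_mul, Finset.sum_const_zero, add_zero])
  convert h using 1
  simp only [Fintype.card_sum, Fintype.card_prod, Fintype.card_fin, Fintype.card_bool, hP]
  ring

end

/-! ### Existence of real embeddings -/

/-- Hilbert's identity: `‖x‖ ^ (2 * P)` is a sum of powers of linear forms. -/
theorem exists_hasIsometricEmbedding_real {d : ℕ} (hd : 0 < d) {P : ℕ} (hP : 0 < P) :
    ∃ n, HasIsometricEmbedding ℝ d (2 * P) n := by
  induction d, hd using Nat.le_induction with
  | base =>
    exact ⟨_, HasIsometricEmbedding.of_sum_eq (F := ℝ) (ι := Unit) hP (c := fun _ _ => 1)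
      (w := fun _ => 1) (fun _ => zero_le_one) one_pos fun x => by simp [pow_mul]⟩
  | succ d hd ih =>
    obtain ⟨n, hn⟩ := ih
    obtain ⟨a, ha⟩ := hn.exists_isCubature (even_two_mul P) (by omega)
    -- On the line a single vector is a cubature of every even degree, so the product construction
    -- over `ℝ` needs only `a` from the induction hypothesis.
    have hR : IsCubature (2 * P) (fun _ : Fin 1 => (1 : ℝ)) := fun x => by simp [pow_mul]
    obtain ⟨N, hN | hN⟩ := Nat.even_or_odd' P
    · exact ⟨_, hasIsometricEmbedding_of_isCubature_even (F := ℝ) hd (Nat.div_le_self P 2) hP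
        (by omega) hN ⟨1, _, hR⟩ hR ha⟩
    · exact ⟨_, hasIsometricEmbedding_of_isCubature_odd (F := ℝ) (N := N + 1) hd
        (Nat.div_le_self P 2) hP (by omega) ⟨1, _, hR⟩ hR ha⟩

/-! ### The bounds for the three fields -/

namespace ClassicalField

theorem real_embeddingDims_nonempty {d q : ℕ} (hd : 0 < d) (hq : Even q) (hq0 : 0 < q) :
    (real.embeddingDims d q).Nonempty := by
  obtain ⟨P, rfl⟩ := even_iff_two_dvd.1 hq
  exact exists_hasIsometricEmbedding_real hd (by omega)

/-- A real cubature moves along isometries, so an optimal one for `ℝ ^ d` serves `F` and `F ^ k`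
regarded as real Euclidean spaces. -/
theorem exists_isCubature_minDim {E : Type*} [NormedAddCommGroup E] [InnerProductSpace ℝ E]
    [FiniteDimensional ℝ E] {d q : ℕ} (hE : Module.finrank ℝ E = d) (hd : 0 < d) (hq : Even q)
    (hq0 : 0 < q) : ∃ a : Fin (real.minDim d q) → E, IsCubature q a := by
  have h : HasIsometricEmbedding ℝ d q (real.minDim d q) :=
    Nat.sInf_mem (real_embeddingDims_nonempty hd hq hq0)
  obtain ⟨a, ha⟩ := h.exists_isCubature hq hq0
  exact ha.exists_of_finrank_eq (by rw [finrank_euclideanSpace_fin, hE])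

section

variable {F : Type} [NormedDivisionRing F] [InnerProductSpace ℝ F] [SMulCommClass ℝ F F]
  [IsScalarTower ℝ F F] [FiniteDimensional ℝ F]

theorem hasIsometricEmbedding_minDim_odd {δ m p : ℕ} (hδ : Module.finrank ℝ F = δ) (hm : 2 ≤ m)
    (hp : 4 ≤ p) (hp4 : p % 4 = 2) :
    HasIsometricEmbedding F m p
      (real.minDim δ (p / 2 - 1) * (p / 2 + 1) * real.minDim (δ * (m - 1)) p) := by
  have hδ0 : 0 < δ := hδ ▸ Module.finrank_pos
  obtain ⟨k, rfl⟩ := Nat.exists_eq_add_of_le' (show 1 ≤ m by omega)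
  -- Here `P = 2 * r + 1`, so the degree `2⌊P/2⌋` required of the design on `F` is `2 * r = p / 2 -
  -- 1`; `4 ≤ p` ensures `0 < r`.
  obtain ⟨r, rfl⟩ : ∃ r, p = 2 * (2 * r + 1) := ⟨p / 4, by omega⟩
  rw [Nat.mul_div_cancel_left _ two_pos, Nat.add_sub_cancel, Nat.add_sub_cancel]
  obtain ⟨a, ha⟩ := exists_isCubature_minDim hδ hδ0 (even_two_mul r) (by omega)
  obtain ⟨b, hb⟩ := exists_isCubature_minDim hδ hδ0 (even_two_mul (2 * r + 1)) (by omega)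
  obtain ⟨w, hw⟩ := exists_isCubature_minDim (E := PiLp 2 (fun _ : Fin k => F))
    (by rw [finrank_piLp_two, hδ, mul_comm]) (Nat.mul_pos hδ0 (show 0 < k by omega))
    (even_two_mul (2 * r + 1)) (by omega)
  exact hasIsometricEmbedding_of_isCubature_odd (N := r + 1) (by omega) (by omega) (by omega)
    (by omega) ⟨_, b, hb⟩ ha hw

theorem hasIsometricEmbedding_minDim_even {δ m p : ℕ} (hδ : Module.finrank ℝ F = δ) (hm : 2 ≤ m)
    (hp : 4 ≤ p) (hp4 : p % 4 = 0) :
    HasIsometricEmbedding F m p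
      (real.minDim δ (p / 2) * (p / 2 * real.minDim (δ * (m - 1)) p + 1)) := by
  have hδ0 : 0 < δ := hδ ▸ Module.finrank_pos
  obtain ⟨k, rfl⟩ := Nat.exists_eq_add_of_le' (show 1 ≤ m by omega)
  obtain ⟨r, rfl⟩ : ∃ r, p = 2 * (2 * r) := ⟨p / 4, by omega⟩
  rw [Nat.mul_div_cancel_left _ two_pos, Nat.add_sub_cancel]
  obtain ⟨a, ha⟩ := exists_isCubature_minDim hδ hδ0 (even_two_mul r) (by omega)
  obtain ⟨b, hb⟩ := exists_isCubature_minDim hδ hδ0 (even_two_mul (2 * r)) (by omega)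
  obtain ⟨w, hw⟩ := exists_isCubature_minDim (E := PiLp 2 (fun _ : Fin k => F))
    (by rw [finrank_piLp_two, hδ, mul_comm]) (Nat.mul_pos hδ0 (show 0 < k by omega))
    (even_two_mul (2 * r)) (by omega)
  exact hasIsometricEmbedding_of_isCubature_even (N := r) (by omega) (by omega) (by omega)
    (by omega) rfl ⟨_, b, hb⟩ ha hw

end

theorem realDim_pos (K : ClassicalField) : 0 < K.realDim := by
  cases K <;> decide

theorem mem_embeddingDims_odd (K : ClassicalField) {m p : ℕ} (hm : 2 ≤ m) (hp : 4 ≤ p)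
    (hp4 : p % 4 = 2) :
    real.minDim K.realDim (p / 2 - 1) * (p / 2 + 1) * real.minDim (K.realDim * (m - 1)) p ∈
      K.embeddingDims m p := by
  cases K with
  | real => exact hasIsometricEmbedding_minDim_odd (Module.finrank_self ℝ) hm hp hp4
  | complex => exact hasIsometricEmbedding_minDim_odd Complex.finrank_real_complex hm hp hp4
  | quaternion => exact hasIsometricEmbedding_minDim_odd Quaternion.finrank_eq_four hm hp hp4

theorem mem_embeddingDims_even (K : ClassicalField) {m p : ℕ} (hm : 2 ≤ m) (hp : 4 ≤ p)
    (hp4 : p % 4 = 0) :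
    real.minDim K.realDim (p / 2) * (p / 2 * real.minDim (K.realDim * (m - 1)) p + 1) ∈
      K.embeddingDims m p := by
  cases K with
  | real => exact hasIsometricEmbedding_minDim_even (Module.finrank_self ℝ) hm hp hp4
  | complex => exact hasIsometricEmbedding_minDim_even Complex.finrank_real_complex hm hp hp4
  | quaternion => exact hasIsometricEmbedding_minDim_even Quaternion.finrank_eq_four hm hp hp4

end ClassicalField

theorem corollary1p6 (K : ClassicalField) (m p : ℕ) (hm : 2 ≤ m) (hp : 4 ≤ p) :
    (p % 4 = 2 →
      (K.embeddingDims m p).Nonempty ∧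
      (ClassicalField.real.embeddingDims K.realDim (p / 2 - 1)).Nonempty ∧
      (ClassicalField.real.embeddingDims (K.realDim * (m - 1)) p).Nonempty ∧
      K.minDim m p ≤
        ClassicalField.real.minDim K.realDim (p / 2 - 1) * (p / 2 + 1) *
          ClassicalField.real.minDim (K.realDim * (m - 1)) p) ∧
    (p % 4 = 0 →
      (K.embeddingDims m p).Nonempty ∧
      (ClassicalField.real.embeddingDims K.realDim (p / 2)).Nonempty ∧
      (ClassicalField.real.embeddingDims (K.realDim * (m - 1)) p).Nonempty ∧
      K.minDim m p ≤
        ClassicalField.real.minDim K.realDim (p / 2) *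
          (p / 2 * ClassicalField.real.minDim (K.realDim * (m - 1)) p + 1)) := by
  have hδ := K.realDim_pos
  have hD : 0 < K.realDim * (m - 1) := Nat.mul_pos hδ (by omega)
  refine ⟨fun h => ?_, fun h => ?_⟩
  · have hmem := K.mem_embeddingDims_odd hm hp h
    exact ⟨⟨_, hmem⟩,
      ClassicalField.real_embeddingDims_nonempty hδ (Nat.even_iff.2 (by omega)) (by omega),
      ClassicalField.real_embeddingDims_nonempty hD (Nat.even_iff.2 (by omega)) (by omega),
      Nat.sInf_le hmem⟩
  · have hmem := K.mem_embeddingDims_even hm hp h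
    exact ⟨⟨_, hmem⟩,
      ClassicalField.real_embeddingDims_nonempty hδ (Nat.even_iff.2 (by omega)) (by omega),
      ClassicalField.real_embeddingDims_nonempty hD (Nat.even_iff.2 (by omega)) (by omega),
      Nat.sInf_le hmem⟩
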